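/- A hypergraph is a pair $H=(V,E)$ with $V$ a set and $E$ a family of subsets of $V$; a subset of $V$ is independent in $H$ if it contains no edge of $H$. For $k\ge 2$, $H$ is $k$-partite $k$-uniform if every edge has exactly $k$ vertices and $V$ is the disjoint union of $k$ sets $V_1,\dots,V_k$ such that every edge meets each $V_i$ in exactly one vertex. The degree of a vertex is the number of edges containing it. A cooperative coloring of hypergraphs $H_1,\dots,H_m$ (not necessarily distinct) on the same vertex set $V$ is a partition $V=I_1\sqcup\dots\sqcup I_m$ (empty classes allowed) such that $I_i$ is independent in $H_i$ for every $i$. Let $m_{\mathcal B_k}(d)$ be the least $m$ such that any $m$ $k$-partite $k$-uniform hypergraphs on a common vertex set, each of maximum degree at most $d$, have a cooperative coloring. Theorem. Let $k\ge 2$ be an integer. For every integer $d\ge 2$ the number $m_{\mathcal B_k}(d)$ exists (is finite), and $$\frac{\log_k d}{k-1}\;\le\; m_{\mathcal B_k}(d)\;\le\; k\,(1+o(1))\left(\frac{(k-1)\,d}{\ln d}\right)^{\frac1{k-1}},$$ where $o(1)$ denotes a function of $d$ (depending on $k$) that tends to $0$ as $d\to\infty$ with $k$ fixed. -/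

import Mathlib

open Filter Topology

universe u

namespace Hypergraph

/-- A set of vertices of `H` is independent if it contains no edge of `H`. -/
def IsIndependentSet {α : Type u} (H : Hypergraph α) (I : Set α) : Prop :=
  I ⊆ H.vertexSet ∧ ∀ e ∈ H.edgeSet, ¬ e ⊆ I

/-- Every edge has exactly `k` vertices. -/
def IsUniform {α : Type u} (H : Hypergraph α) (k : ℕ) : Prop :=
  ∀ e ∈ H.edgeSet, e.encard = k

/-- The vertex set splits into `k` pairwise disjoint parts (some of which may be empty), and every
edge meets every part in exactly one vertex. -/
def IsMultipartite {α : Type u} (H : Hypergraph α) (k : ℕ) : Prop :=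
  ∃ P : Fin k → Set α, Pairwise (fun i j => Disjoint (P i) (P j)) ∧ (⋃ i, P i) = H.vertexSet ∧
    ∀ e ∈ H.edgeSet, ∀ i, (e ∩ P i).encard = 1

/-- The degree of `v`: the number of edges that contain `v`. -/
noncomputable def edgeDegree {α : Type u} (H : Hypergraph α) (v : α) : ℕ∞ :=
  {e ∈ H.edgeSet | v ∈ e}.encard

/-- The maximum degree is at most `d`. -/
def MaxDegreeLE {α : Type u} (H : Hypergraph α) (d : ℕ) : Prop :=
  ∀ v ∈ H.vertexSet, H.edgeDegree v ≤ d

/-- `I 0, …, I (m - 1)` is a cooperative coloring of the hypergraphs `H 0, …, H (m - 1)` on the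
common vertex set `V`: a partition of `V` (empty classes are allowed) such that `I i` is an
independent set of `H i`. -/
def IsCooperativeColoring {α : Type u} {m : ℕ} (V : Set α) (H : Fin m → Hypergraph α)
    (I : Fin m → Set α) : Prop :=
  Pairwise (fun i j => Disjoint (I i) (I j)) ∧ (⋃ i, I i) = V ∧ ∀ i, (H i).IsIndependentSet (I i)

/-- Any `m` (not necessarily distinct) hypergraphs of the class `𝓗` with the same vertex set have
a cooperative coloring. -/
def AlwaysCooperative (𝓗 : ∀ α : Type u, Set (Hypergraph α)) (m : ℕ) : Prop :=
  ∀ (α : Type u) (V : Set α) (H : Fin m → Hypergraph α),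
    (∀ i, H i ∈ 𝓗 α) → (∀ i, (H i).vertexSet = V) →
      ∃ I : Fin m → Set α, IsCooperativeColoring V H I

/-- `n` is the cooperative chromatic number of the class `𝓗`: the least number of hypergraphs of
`𝓗` that always have a cooperative coloring. -/
def IsCooperativeChromaticNumber (𝓗 : ∀ α : Type u, Set (Hypergraph α)) (n : ℕ) : Prop :=
  IsLeast {m : ℕ | AlwaysCooperative 𝓗 m} n

/-- The class of `k`-partite `k`-uniform hypergraphs of maximum degree at most `d`. -/
def multipartiteClass (k d : ℕ) (α : Type u) : Set (Hypergraph α) :=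
  {H | H.IsUniform k ∧ H.IsMultipartite k ∧ H.MaxDegreeLE d}

end Hypergraph

open Finset

/-! Upper bound. Write `n = k - 1` and take `(n + 1) * s` colors. Color `i` puts a vertex into one
of the `n + 1` parts of its hypergraph, so by pigeonhole every `v` has a list `S v` of `s` colors
that all put it into the same part `τ v`. Choose `c v ∈ S v` uniformly and independently. Vertices
with `τ v` not the last part keep `c v`; the others switch to a color in their list that is not
blocked by `c`. An edge of `E i` that became monochromatic in color `i` would have exactly one
switching vertex, and its other vertices would block `i` there (`exists_coloring_of_transversal`).
Such a `c` exists by the local lemma. Blocking of one color is controlled by Harris' inequality and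
blocking of all `s` colors by negative association, so the failure probability at `v` is at most `(1
- (1 - s⁻ⁿ) ^ d) ^ s`. This is at most `d⁻⁵` for large `d` once `s` slightly exceeds `(n d / log d)
^ (1 / n)`, while the dependency degree is at most of order `d ^ 4`. Compactness handles infinite
vertex sets. Lower bound. On words of length `m` over `k` letters, let the `i`-th hypergraph be
complete `k`-partite with respect to the `i`-th letter. An independent set misses a letter, and the
word made of the missed letters lies in no class. -/

lemma sum_biUnion_le_sum_sum {κ Ω : Type*} [DecidableEq κ] [DecidableEq Ω] {W : Ω → ℝ}
    (hW : ∀ ω, 0 ≤ W ω) (s : Finset κ) (t : κ → Finset Ω) :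
    ∑ ω ∈ s.biUnion t, W ω ≤ ∑ v ∈ s, ∑ ω ∈ t v, W ω := by
  induction s using Finset.induction_on with
  | empty => simp
  | insert v s hv ih =>
    rw [biUnion_insert, sum_insert hv]
    have h1 := sum_union_inter (s₁ := t v) (s₂ := s.biUnion t) (f := W)
    have h2 : 0 ≤ ∑ ω ∈ t v ∩ s.biUnion t, W ω := sum_nonneg fun ω _ => hW ω
    linarith

/-! ### The Lovász local lemma -/

section LocalLemma

variable {Ω κ : Type*} [Fintype Ω] [DecidableEq Ω] [Fintype κ] [DecidableEq κ]

/-- The outcomes that lie in none of the events `A v`, `v ∈ T`. -/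
def avoiding (A : κ → Finset Ω) (T : Finset κ) : Finset Ω :=
  univ.filter fun ω => ∀ v ∈ T, ω ∉ A v

lemma avoiding_anti (A : κ → Finset Ω) {S T : Finset κ} (h : S ⊆ T) :
    avoiding A T ⊆ avoiding A S := by
  intro ω hω
  simp only [avoiding, mem_filter, mem_univ, true_and] at hω ⊢
  exact fun v hv => hω v (h hv)

/-- If `A v` has relative weight at most `p` given that any events outside `Γ v` are avoided, then
it has relative weight at most `2 p` given that any events are avoided. -/
lemma sum_inter_avoiding_le {W : Ω → ℝ} (hW : ∀ ω, 0 ≤ W ω) {A : κ → Finset Ω}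
    {Γ : κ → Finset κ} {p : ℝ} {D : ℕ} (hp : 0 ≤ p)
    (hind : ∀ v T, Disjoint T (Γ v) →
      ∑ ω ∈ A v ∩ avoiding A T, W ω ≤ p * ∑ ω ∈ avoiding A T, W ω)
    (hΓ : ∀ v, #(Γ v) ≤ D) (hpD : 4 * p * D ≤ 1) (T : Finset κ) (v : κ) :
    ∑ ω ∈ A v ∩ avoiding A T, W ω ≤ 2 * p * ∑ ω ∈ avoiding A T, W ω := by
  induction hn : #T using Nat.strong_induction_on generalizing T v with
  | _ n ih =>
  have hnn : ∀ S : Finset Ω, 0 ≤ ∑ ω ∈ S, W ω := fun S => sum_nonneg fun ω _ => hW ω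
  by_cases hd : Disjoint T (Γ v)
  · have := hind v T hd
    nlinarith [mul_nonneg hp (hnn (avoiding A T))]
  have hlt : #(T \ Γ v) < n := by
    rw [← hn]
    refine card_lt_card ⟨sdiff_subset, fun h => hd ?_⟩
    rw [disjoint_left]
    intro a ha
    exact (mem_sdiff.1 (h ha)).2
  -- Drop the events dependent on `v`: the hypothesis applies to `T₂`, and induction bounds what the
  -- dropped events take from its avoiding set.
  set T₂ := T \ Γ v with hT₂
  have h1 : ∑ ω ∈ A v ∩ avoiding A T, W ω ≤ p * ∑ ω ∈ avoiding A T₂, W ω :=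
    (sum_le_sum_of_subset_of_nonneg
      (inter_subset_inter_left (avoiding_anti A sdiff_subset)) fun ω _ _ => hW ω).trans
      (hind v T₂ sdiff_disjoint)
  have h2 : ∑ ω ∈ avoiding A T₂, W ω ≤ ∑ ω ∈ avoiding A T, W ω +
      ∑ w ∈ Γ v, ∑ ω ∈ A w ∩ avoiding A T₂, W ω := by
    have hsub : avoiding A T₂ ⊆ avoiding A T ∪ (Γ v).biUnion fun w => A w ∩ avoiding A T₂ := by
      intro ω hω
      by_cases h : ∃ w ∈ Γ v, ω ∈ A w
      · obtain ⟨w, hw, hωw⟩ := h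
        exact mem_union_right _ (mem_biUnion.2 ⟨w, hw, mem_inter.2 ⟨hωw, hω⟩⟩)
      · push Not at h
        refine mem_union_left _ ?_
        simp only [avoiding, mem_filter, mem_univ, true_and, hT₂] at hω ⊢
        intro w hw
        by_cases hg : w ∈ Γ v
        · exact h w hg
        · exact hω w (mem_sdiff.2 ⟨hw, hg⟩)
    calc _ ≤ ∑ ω ∈ avoiding A T ∪ (Γ v).biUnion fun w => A w ∩ avoiding A T₂, W ω :=
          sum_le_sum_of_subset_of_nonneg hsub fun ω _ _ => hW ω
      _ ≤ ∑ ω ∈ avoiding A T, W ω + ∑ ω ∈ (Γ v).biUnion fun w => A w ∩ avoiding A T₂, W ω := by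
          rw [← sum_union_inter]
          linarith [hnn (avoiding A T ∩ (Γ v).biUnion fun w => A w ∩ avoiding A T₂)]
      _ ≤ _ := by
          gcongr
          exact sum_biUnion_le_sum_sum hW _ _
  have h3 : ∑ w ∈ Γ v, ∑ ω ∈ A w ∩ avoiding A T₂, W ω ≤
      D * (2 * p * ∑ ω ∈ avoiding A T₂, W ω) := by
    calc _ ≤ ∑ w ∈ Γ v, 2 * p * ∑ ω ∈ avoiding A T₂, W ω :=
          sum_le_sum fun w _ => ih _ hlt T₂ w rfl
      _ = #(Γ v) * (2 * p * ∑ ω ∈ avoiding A T₂, W ω) := by rw [sum_const, nsmul_eq_mul]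
      _ ≤ _ := by
          have := hnn (avoiding A T₂)
          gcongr
          exact hΓ v
  -- By `4 p D ≤ 1` the dropped events cost at most half of the weight; this is the source of the
  -- factor 2.
  have h4 : D * (2 * p * ∑ ω ∈ avoiding A T₂, W ω) ≤ (∑ ω ∈ avoiding A T₂, W ω) / 2 := by
    nlinarith [hnn (avoiding A T₂)]
  have h5 : ∑ ω ∈ avoiding A T₂, W ω ≤ 2 * ∑ ω ∈ avoiding A T, W ω := by linarith
  nlinarith

/-- The symmetric **Lovász local lemma** for a finite weighted set of outcomes. -/
theorem exists_pos_forall_notMem_of_local {W : Ω → ℝ} (hW : ∀ ω, 0 ≤ W ω) (hW0 : 0 < ∑ ω, W ω)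
    {A : κ → Finset Ω} {Γ : κ → Finset κ} {p : ℝ} {D : ℕ} (hp : 0 ≤ p) (hp2 : 2 * p < 1)
    (hind : ∀ v T, Disjoint T (Γ v) →
      ∑ ω ∈ A v ∩ avoiding A T, W ω ≤ p * ∑ ω ∈ avoiding A T, W ω)
    (hΓ : ∀ v, #(Γ v) ≤ D) (hpD : 4 * p * D ≤ 1) :
    ∃ ω, 0 < W ω ∧ ∀ v, ω ∉ A v := by
  -- Each further event removes at most a fraction `2 p < 1` of the remaining weight.
  have hpos : ∀ T : Finset κ, 0 < ∑ ω ∈ avoiding A T, W ω := by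
    intro T
    induction T using Finset.induction_on with
    | empty => simpa [avoiding] using hW0
    | insert v T _ ih =>
      have h1 := sum_inter_avoiding_le hW hp hind hΓ hpD T v
      have h2 : avoiding A (insert v T) = avoiding A T \ A v := by
        ext ω
        simp [avoiding, and_comm]
      have h3 := sum_inter_add_sum_sdiff (avoiding A T) (A v) W
      rw [inter_comm] at h3
      rw [h2]
      nlinarith
  obtain ⟨ω, hω, h⟩ := exists_lt_of_sum_lt (s := avoiding A univ) (f := fun _ => (0 : ℝ)) (g := W)
    (by simpa using hpos univ)
  exact ⟨ω, h, fun v => (mem_filter.1 hω).2 v (mem_univ v)⟩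

end LocalLemma

/-! ### Independence under product weights -/

section ProductWeight

variable {U ι : Type*} [Fintype U] [DecidableEq U] [Fintype ι]

lemma sum_prod_weight (w : U → ι → ℝ) (hw : ∀ u, ∑ i, w u i = 1) :
    ∑ c : U → ι, ∏ u, w u (c u) = 1 := by
  rw [← Fintype.prod_sum]
  simp [hw]

variable [DecidableEq ι]

/-- For a product weight, events that depend on disjoint sets of coordinates are independent. -/
lemma sum_inter_eq_mul_of_dependsOn (w : U → ι → ℝ) (hw : ∀ u, ∑ i, w u i = 1) (N : Finset U)
    {A B : Finset (U → ι)} (hA : ∀ c c', (∀ u ∈ N, c u = c' u) → c ∈ A → c' ∈ A)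
    (hB : ∀ c c', (∀ u ∉ N, c u = c' u) → c ∈ B → c' ∈ B) :
    ∑ c ∈ A ∩ B, ∏ u, w u (c u) =
      (∑ c ∈ A, ∏ u, w u (c u)) * ∑ c ∈ B, ∏ u, w u (c u) := by
  -- A factor equal to 1 turns both sides into sums over pairs of colorings; exchanging the
  -- coordinates outside `N` matches them.
  have h1 : ∑ c ∈ A ∩ B, ∏ u, w u (c u) =
      (∑ c ∈ A ∩ B, ∏ u, w u (c u)) * ∑ c : U → ι, ∏ u, w u (c u) := by
    rw [sum_prod_weight w hw, mul_one]
  rw [h1, sum_mul_sum, sum_mul_sum, ← sum_product', ← sum_product']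
  refine sum_nbij' (fun x => (N.piecewise x.1 x.2, N.piecewise x.2 x.1))
    (fun x => (N.piecewise x.1 x.2, N.piecewise x.2 x.1)) ?_ ?_ ?_ ?_ ?_
  · rintro ⟨c, c'⟩ h
    simp only [mem_product, mem_inter, mem_univ, and_true] at h ⊢
    exact ⟨hA c _ (fun u hu => by simp [hu]) h.1, hB c _ (fun u hu => by simp [hu]) h.2⟩
  · rintro ⟨c, c'⟩ h
    simp only [mem_product, mem_inter, mem_univ, and_true] at h ⊢
    exact ⟨hA c _ (fun u hu => by simp [hu]) h.1, hB c' _ (fun u hu => by simp [hu]) h.2⟩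
  · rintro ⟨c, c'⟩ _
    simp only [Prod.mk.injEq]
    constructor <;> (ext u; by_cases hu : u ∈ N <;> simp [hu])
  · rintro ⟨c, c'⟩ _
    simp only [Prod.mk.injEq]
    constructor <;> (ext u; by_cases hu : u ∈ N <;> simp [hu])
  · rintro ⟨c, c'⟩ _
    simp only [← prod_mul_distrib]
    refine prod_congr rfl fun u _ => ?_
    by_cases hu : u ∈ N <;> simp [hu, mul_comm]

end ProductWeight

/-! ### Harris' inequality for Bernoulli weights -/

section Bernoulli

variable {U : Type*} [Fintype U]

/-- The product of Bernoulli weights: the coordinate `u` is `true` with probability `q u`. -/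
def bernoulliWeight (q : U → ℝ) (x : U → Bool) : ℝ :=
  ∏ u, if x u then q u else 1 - q u

lemma bernoulliWeight_nonneg {q : U → ℝ} (h0 : ∀ u, 0 ≤ q u) (h1 : ∀ u, q u ≤ 1) (x : U → Bool) :
    0 ≤ bernoulliWeight q x :=
  prod_nonneg fun u _ => by
    split_ifs
    · exact h0 u
    · linarith [h1 u]

variable [DecidableEq U]

lemma sum_bernoulliWeight (q : U → ℝ) : ∑ x, bernoulliWeight q x = 1 := by
  have h := Fintype.prod_sum fun (u : U) (b : Bool) => if b then q u else 1 - q u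
  unfold bernoulliWeight
  rw [← h]
  simp

lemma sum_bernoulliWeight_forall_mem (q : U → ℝ) (f : Finset U) :
    ∑ x, bernoulliWeight q x * (if ∀ u ∈ f, x u then 1 else 0) = ∏ u ∈ f, q u := by
  have h := Fintype.prod_sum fun (u : U) (b : Bool) =>
    (if b then q u else 1 - q u) * if u ∈ f → b = true then 1 else 0
  have h2 : ∀ x : U → Bool, bernoulliWeight q x * (if ∀ u ∈ f, x u then (1 : ℝ) else 0) =
      ∏ u, (if x u then q u else 1 - q u) * if u ∈ f → x u = true then 1 else 0 := by
    intro x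
    rw [prod_mul_distrib, Fintype.prod_ite_zero]
    simp [bernoulliWeight]
  rw [sum_congr rfl fun x _ => h2 x, ← h, ← prod_subset (subset_univ f)]
  · exact prod_congr rfl fun u hu => by simp [hu]
  · intro u _ hu
    simp [hu]

/-- Harris' inequality for two increasing functions. -/
lemma sum_bernoulliWeight_mul_le {q : U → ℝ} (h0 : ∀ u, 0 ≤ q u) (h1 : ∀ u, q u ≤ 1)
    {f g : (U → Bool) → ℝ} (hf₀ : 0 ≤ f) (hg₀ : 0 ≤ g) (hf : Monotone f) (hg : Monotone g) :
    (∑ x, bernoulliWeight q x * f x) * ∑ x, bernoulliWeight q x * g x ≤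
      ∑ x, bernoulliWeight q x * (f x * g x) := by
  have h := fkg (μ := bernoulliWeight q) (f := f) (g := g) (bernoulliWeight_nonneg h0 h1) hf₀ hg₀
    hf hg ?_
  · rwa [sum_bernoulliWeight, one_mul] at h
  · intro a b
    unfold bernoulliWeight
    rw [← prod_mul_distrib, ← prod_mul_distrib]
    refine (prod_congr rfl fun u _ => ?_).le
    cases ha : a u <;> cases hb : b u <;> simp [ha, hb, mul_comm]

/-- The probability that no set of a family lies in a random set is at least what it would be if
the sets were disjoint. -/
lemma prod_one_sub_prod_le {q : U → ℝ} (h0 : ∀ u, 0 ≤ q u) (h1 : ∀ u, q u ≤ 1)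
    (F : Finset (Finset U)) :
    ∏ f ∈ F, (1 - ∏ u ∈ f, q u) ≤
      1 - ∑ x, bernoulliWeight q x * (if ∃ f ∈ F, ∀ u ∈ f, x u then 1 else 0) := by
  induction F using Finset.induction_on with
  | empty => simp
  | insert f F hf ih =>
    rw [prod_insert hf]
    have hle : ∏ u ∈ f, q u ≤ 1 := prod_le_one (fun u _ => h0 u) fun u _ => h1 u
    refine (mul_le_mul_of_nonneg_left ih (by linarith)).trans ?_
    rw [← sum_bernoulliWeight_forall_mem q f]
    have key := sum_bernoulliWeight_mul_le h0 h1
      (f := fun x => if ∀ u ∈ f, x u then 1 else 0)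
      (g := fun x => if ∃ f ∈ F, ∀ u ∈ f, x u then 1 else 0)
      (fun x => by dsimp; positivity) (fun x => by dsimp; positivity) ?_ ?_
    -- Inclusion–exclusion; Harris bounds the intersection term from below.
    · have hsplit : ∀ x : U → Bool,
          bernoulliWeight q x * (if ∃ f' ∈ insert f F, ∀ u ∈ f', x u then (1 : ℝ) else 0) =
          bernoulliWeight q x * (if ∀ u ∈ f, x u then 1 else 0) +
          bernoulliWeight q x * (if ∃ f ∈ F, ∀ u ∈ f, x u then 1 else 0) -
          bernoulliWeight q x * ((if ∀ u ∈ f, x u then 1 else 0) *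
            (if ∃ f ∈ F, ∀ u ∈ f, x u then 1 else 0)) := by
        intro x
        simp only [exists_mem_insert]
        by_cases ha : ∀ u ∈ f, x u <;> by_cases hb : ∃ f ∈ F, ∀ u ∈ f, x u <;> simp [ha, hb]
      rw [sum_congr rfl fun x _ => hsplit x, sum_sub_distrib, sum_add_distrib]
      nlinarith
    · intro x y hxy
      dsimp only
      split_ifs with h2 h3
      · exact le_rfl
      · exact absurd (fun u hu => Bool.eq_true_of_true_le (h2 u hu ▸ hxy u)) h3
      · exact zero_le_one
      · exact le_rfl
    · intro x y hxy
      dsimp only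
      split_ifs with h2 h3
      · exact le_rfl
      · obtain ⟨f', hf', h2⟩ := h2
        exact absurd ⟨f', hf', fun u hu => Bool.eq_true_of_true_le (h2 u hu ▸ hxy u)⟩ h3
      · exact zero_le_one
      · exact le_rfl

end Bernoulli

/-! ### Negative association of balls in bins -/

section NegativeAssociation

variable {ι : Type*} [DecidableEq ι]

/-- The case of a single ball, which hits at most one bin, against independent bins with the same
marginals. When a bin `a` is added, the new gain `w a * (F a true - F a false)` is multiplied on the
left by the all-`false` product and on the right by the larger mixed product. -/
lemma sum_mul_prod_add_le_prod {w : ι → ℝ} (hw : ∀ i, 0 ≤ w i)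
    {F : ι → Bool → ℝ} (hF0 : ∀ i, 0 ≤ F i false) (hF : ∀ i, F i false ≤ F i true)
    (S : Finset ι) :
    ∑ j ∈ S, w j * ∏ i ∈ S, F i (decide (j = i)) +
        (1 - ∑ j ∈ S, w j) * ∏ i ∈ S, F i false ≤
      ∏ i ∈ S, (w i * F i true + (1 - w i) * F i false) := by
  induction S using Finset.induction_on with
  | empty => simp
  | insert a S ha ih =>
    have hle : ∏ i ∈ S, F i false ≤ ∏ i ∈ S, (w i * F i true + (1 - w i) * F i false) :=
      prod_le_prod (fun i _ => hF0 i) fun i _ => by nlinarith [hw i, hF i]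
    have h1 : ∑ j ∈ S, w j * ∏ i ∈ insert a S, F i (decide (j = i)) =
        F a false * ∑ j ∈ S, w j * ∏ i ∈ S, F i (decide (j = i)) := by
      rw [mul_sum]
      refine sum_congr rfl fun j hj => ?_
      have hja : j ≠ a := fun h => ha (h ▸ hj)
      rw [prod_insert ha]
      simp only [hja, decide_false]
      ring
    have h2 : ∏ i ∈ insert a S, F i (decide (a = i)) = F a true * ∏ i ∈ S, F i false := by
      rw [prod_insert ha]
      simp only [decide_true]
      congr 1
      refine prod_congr rfl fun i hi => ?_
      have hia : a ≠ i := fun h => ha (h ▸ hi)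
      simp [hia]
    rw [sum_insert ha, sum_insert ha, h1, h2, prod_insert ha, prod_insert ha]
    have h3 := mul_le_mul_of_nonneg_left ih (hF0 a)
    have h4 := mul_le_mul_of_nonneg_left hle (mul_nonneg (hw a) (sub_nonneg.2 (hF a)))
    linarith

variable [Fintype ι]

/-- Negative association of balls in bins: if every `u` chooses `c u` independently, then
increasing functions of the sets of those who choose `i`, for different `i`, have an expected
product at most the product of their expectations. -/
lemma sum_prod_weight_mul_prod_le_fin (n : ℕ) {w : Fin n → ι → ℝ} (hw : ∀ u i, 0 ≤ w u i)
    (hw1 : ∀ u, ∑ i, w u i = 1) {g : ι → (Fin n → Bool) → ℝ} (hg0 : ∀ i x, 0 ≤ g i x)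
    (hg : ∀ i, Monotone (g i)) :
    ∑ c : Fin n → ι, (∏ u, w u (c u)) * ∏ i, g i (fun u => decide (c u = i)) ≤
      ∏ i, ∑ x, bernoulliWeight (fun u => w u i) x * g i x := by
  induction n with
  | zero =>
    simp only [bernoulliWeight, univ_eq_empty, prod_empty, one_mul, Fintype.sum_unique]
    exact (prod_congr rfl fun i _ => congrArg _ (Subsingleton.elim _ _)).le
  | succ n ih =>
    have hb1 : ∀ u i, w u i ≤ 1 := fun u i => by
      rw [← hw1 u]
      exact single_le_sum (fun j _ => hw u j) (mem_univ i)
    -- The expectation of `g i` given that coordinate `0` is `b`: induction treats the remaining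
    -- balls, and the one-ball inequality treats ball `0`.
    set F : ι → Bool → ℝ := fun i b =>
      ∑ x, bernoulliWeight (fun u => w (Fin.succ u) i) x * g i (Fin.cons b x) with hFdef
    have hcons : ∀ (i j : ι) (c : Fin n → ι),
        (fun u => decide ((Fin.cons j c : Fin (n + 1) → ι) u = i)) =
          (Fin.cons (decide (j = i)) (fun u => decide (c u = i)) : Fin (n + 1) → Bool) := by
      intro i j c
      funext u
      refine Fin.cases ?_ (fun u => ?_) u <;> simp
    calc ∑ c : Fin (n + 1) → ι, (∏ u, w u (c u)) * ∏ i, g i (fun u => decide (c u = i))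
        = ∑ j, w 0 j * ∑ c : Fin n → ι, (∏ u, w (Fin.succ u) (c u)) *
            ∏ i, g i (Fin.cons (decide (j = i)) (fun u => decide (c u = i))) := by
          rw [← (Fin.consEquiv fun _ => ι).sum_comp, Fintype.sum_prod_type]
          refine sum_congr rfl fun j _ => ?_
          rw [mul_sum]
          refine sum_congr rfl fun c _ => ?_
          simp only [Fin.consEquiv_apply, Fin.prod_univ_succ, Fin.cons_zero, Fin.cons_succ, hcons]
          ring
      _ ≤ ∑ j, w 0 j * ∏ i, F i (decide (j = i)) := by
          refine sum_le_sum fun j _ => mul_le_mul_of_nonneg_left ?_ (hw 0 j)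
          refine ih (g := fun i x => g i (Fin.cons (decide (j = i)) x)) (fun u => hw _)
            (fun u => hw1 _) (fun i x => hg0 i _) fun i x y hxy => hg i ?_
          exact Fin.cons_le_cons.2 ⟨le_rfl, hxy⟩
      _ ≤ ∏ i, (w 0 i * F i true + (1 - w 0 i) * F i false) := by
          have hnn : ∀ i x, 0 ≤ bernoulliWeight (fun u : Fin n => w (Fin.succ u) i) x :=
            fun i => bernoulliWeight_nonneg (fun u => hw _ i) fun u => hb1 _ i
          have := sum_mul_prod_add_le_prod (hw 0) (F := F)
            (fun i => sum_nonneg fun x _ => mul_nonneg (hnn i x) (hg0 i _))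
            (fun i => sum_le_sum fun x _ => mul_le_mul_of_nonneg_left
              (hg i (Fin.cons_le_cons.2 ⟨Bool.false_le _, le_rfl⟩)) (hnn i x)) univ
          simpa [hw1] using this
      _ = _ := by
          refine prod_congr rfl fun i _ => ?_
          rw [← (Fin.consEquiv fun _ => Bool).sum_comp, Fintype.sum_prod_type, Fintype.sum_bool]
          simp only [hFdef, mul_sum, Fin.consEquiv_apply, bernoulliWeight, Fin.prod_univ_succ,
            Fin.cons_zero, Fin.cons_succ]
          congr 1 <;> exact sum_congr rfl fun x _ => by simp [mul_assoc, Fin.consEquiv]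

lemma sum_prod_weight_mul_prod_le {U : Type*} [Fintype U] [DecidableEq U] {w : U → ι → ℝ}
    (hw : ∀ u i, 0 ≤ w u i) (hw1 : ∀ u, ∑ i, w u i = 1) {g : ι → (U → Bool) → ℝ}
    (hg0 : ∀ i x, 0 ≤ g i x) (hg : ∀ i, Monotone (g i)) :
    ∑ c : U → ι, (∏ u, w u (c u)) * ∏ i, g i (fun u => decide (c u = i)) ≤
      ∏ i, ∑ x, bernoulliWeight (fun u => w u i) x * g i x := by
  have e := (Fintype.equivFin U).symm
  have h := sum_prod_weight_mul_prod_le_fin (Fintype.card U) (w := fun u => w (e u))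
    (g := fun i x => g i (x ∘ e.symm)) (fun u => hw _) (fun u => hw1 _) (fun i x => hg0 i _)
    (fun i x y hxy => hg i fun u => hxy _)
  convert h using 1
  · refine Fintype.sum_equiv (e.symm.arrowCongr (Equiv.refl ι)) _ _ fun c => ?_
    rw [← e.prod_comp]
    simp [Function.comp_def]
  · refine prod_congr rfl fun i _ => ?_
    refine Fintype.sum_equiv (e.symm.arrowCongr (Equiv.refl Bool)) _ _ fun x => ?_
    simp only [bernoulliWeight]
    rw [← e.prod_comp]
    simp [Function.comp_def]

end NegativeAssociation

/-! ### Random list coloring and recoloring of one part -/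

section Coloring

lemma sum_bernoulliWeight_exists_le {U : Type*} [Fintype U] [DecidableEq U] {q : U → ℝ}
    (h0 : ∀ u, 0 ≤ q u) {r : ℝ} (hq : ∀ u, q u ≤ r) (hr0 : 0 ≤ r) (hr : r ≤ 1)
    {F : Finset (Finset U)} {n d : ℕ} (hn : ∀ f ∈ F, #f = n) (hd : #F ≤ d) :
    ∑ x, bernoulliWeight q x * (if ∃ f ∈ F, ∀ u ∈ f, x u then 1 else 0) ≤
      1 - (1 - r ^ n) ^ d := by
  have hrn0 : 0 ≤ r ^ n := pow_nonneg hr0 n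
  have hrn : r ^ n ≤ 1 := pow_le_one₀ hr0 hr
  have h1 := prod_one_sub_prod_le h0 (fun u => (hq u).trans hr) F
  have h2 : (1 - r ^ n) ^ d ≤ ∏ f ∈ F, (1 - ∏ u ∈ f, q u) := by
    calc (1 - r ^ n) ^ d ≤ (1 - r ^ n) ^ #F :=
          pow_le_pow_of_le_one (by linarith) (by linarith) hd
      _ = ∏ f ∈ F, (1 - r ^ n) := by rw [prod_const]
      _ ≤ _ := by
          refine prod_le_prod (fun f _ => by linarith) fun f hf => ?_
          have : ∏ u ∈ f, q u ≤ ∏ u ∈ f, r := prod_le_prod (fun u _ => h0 u) fun u _ => hq u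
          rw [prod_const, hn f hf] at this
          linarith
  linarith

section Neighbors

variable {V ι : Type*} [DecidableEq V] [Fintype ι]

/-- The neighbors of `v` in any of the hypergraphs `E i`. -/
def neighbors (E : ι → Finset (Finset V)) (v : V) : Finset V :=
  univ.biUnion fun i => ((E i).filter (v ∈ ·)).biUnion fun e => e.erase v

lemma mem_neighbors {E : ι → Finset (Finset V)} {u v : V} :
    u ∈ neighbors E v ↔ ∃ i, ∃ e ∈ E i, v ∈ e ∧ u ∈ e.erase v := by
  simp [neighbors, and_assoc]

lemma neighbors_symm {E : ι → Finset (Finset V)} {u v : V} (h : u ∈ neighbors E v) :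
    v ∈ neighbors E u := by
  obtain ⟨i, e, he, hv, hu⟩ := mem_neighbors.1 h
  rw [mem_erase] at hu
  exact mem_neighbors.2 ⟨i, e, he, hu.2, mem_erase.2 ⟨hu.1.symm, hv⟩⟩

lemma card_neighbors_le {E : ι → Finset (Finset V)} {n d : ℕ}
    (hE : ∀ i, ∀ e ∈ E i, #e = n + 1) (hd : ∀ i v, #((E i).filter (v ∈ ·)) ≤ d) (v : V) :
    #(neighbors E v) ≤ Fintype.card ι * (d * n) := by
  refine card_biUnion_le_card_mul _ _ _ fun i _ => ?_
  refine (card_biUnion_le_card_mul _ _ n fun e he => ?_).trans (Nat.mul_le_mul_right _ (hd i v))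
  rw [mem_filter] at he
  rw [card_erase_of_mem he.2, hE i e he.1]
  rfl

end Neighbors

section UniformWeight

variable {V ι : Type*} [DecidableEq ι]

/-- The uniform distribution on `S u`, for every `u`. -/
noncomputable def uniformWeight (S : V → Finset ι) (u : V) (i : ι) : ℝ :=
  if i ∈ S u then (#(S u) : ℝ)⁻¹ else 0

lemma uniformWeight_nonneg (S : V → Finset ι) (u : V) (i : ι) : 0 ≤ uniformWeight S u i := by
  unfold uniformWeight
  positivity

lemma sum_uniformWeight [Fintype ι] {S : V → Finset ι} {u : V} (h : (S u).Nonempty) :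
    ∑ i, uniformWeight S u i = 1 := by
  have : (#(S u) : ℝ) ≠ 0 := by exact_mod_cast h.card_pos.ne'
  simp [uniformWeight, this]

end UniformWeight

variable {V ι : Type*} [Fintype V] [DecidableEq V] [Fintype ι] [DecidableEq ι]

/-- The colorings in which every color `i ∈ S` is blocked at `v`: the other vertices of some edge
of `E i` at `v` all have color `i`. -/
def blockedAt (E : ι → Finset (Finset V)) (S : Finset ι) (v : V) : Finset (V → ι) :=
  univ.filter fun c => ∀ i ∈ S, ∃ e ∈ E i, v ∈ e ∧ ∀ u ∈ e.erase v, c u = i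

/-- Blocking of `i` is an increasing event in the set of vertices colored `i`, so negative
association bounds the probability by a product over the list. Each factor is bounded by Harris, as
a vertex takes a given color with probability at most `s⁻¹`. -/
lemma sum_blockedAt_le {E : ι → Finset (Finset V)} {n d s : ℕ}
    (hE : ∀ i, ∀ e ∈ E i, #e = n + 1) (hd : ∀ i v, #((E i).filter (v ∈ ·)) ≤ d)
    {S : V → Finset ι} (hs : 0 < s) (hS : ∀ u, #(S u) = s) (v : V) :
    ∑ c ∈ blockedAt E (S v) v, ∏ u, uniformWeight S u (c u) ≤
      (1 - (1 - ((s : ℝ)⁻¹) ^ n) ^ d) ^ s := by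
  set w := uniformWeight S with hw
  have hw0 : ∀ u i, 0 ≤ w u i := uniformWeight_nonneg S
  have hw1 : ∀ u, ∑ i, w u i = 1 := fun u =>
    sum_uniformWeight (card_pos.1 (by rw [hS u]; exact hs))
  have hwle : ∀ u i, w u i ≤ 1 := fun u i => by
    rw [← hw1 u]
    exact single_le_sum (fun j _ => hw0 u j) (mem_univ i)
  have hws : ∀ u i, w u i ≤ (s : ℝ)⁻¹ := fun u i => by
    rw [hw, uniformWeight, hS u]
    split_ifs
    · exact le_rfl
    · positivity
  have hs1 : (s : ℝ)⁻¹ ≤ 1 := inv_le_one_of_one_le₀ (by exact_mod_cast hs)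
  set F : ι → Finset (Finset V) := fun i => ((E i).filter (v ∈ ·)).image fun e => e.erase v with hF
  have hFcard : ∀ i, #(F i) ≤ d := fun i => card_image_le.trans (hd i v)
  have hFn : ∀ i, ∀ f ∈ F i, #f = n := by
    intro i f hf
    obtain ⟨e, he, rfl⟩ := mem_image.1 hf
    rw [mem_filter] at he
    rw [card_erase_of_mem he.2, hE i e he.1]
    rfl
  -- The value 1 off the list lets the product run over all colors.
  set g : ι → (V → Bool) → ℝ := fun i x =>
    if i ∈ S v then (if ∃ f ∈ F i, ∀ u ∈ f, x u then 1 else 0) else 1 with hg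
  have hg0 : ∀ i x, 0 ≤ g i x := fun i x => by
    simp only [hg]
    positivity
  have hgm : ∀ i, Monotone (g i) := by
    intro i x y hxy
    simp only [hg]
    split_ifs with h1 h2 h3
    · exact le_rfl
    · obtain ⟨f, hf, h2⟩ := h2
      exact absurd ⟨f, hf, fun u hu => Bool.eq_true_of_true_le (h2 u hu ▸ hxy u)⟩ h3
    · exact zero_le_one
    · exact le_rfl
    · exact le_rfl
  have hblocked : ∀ c, (if c ∈ blockedAt E (S v) v then (1 : ℝ) else 0) =
      ∏ i, g i (fun u => decide (c u = i)) := by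
    intro c
    have h1 : ∀ i, g i (fun u => decide (c u = i)) =
        if i ∈ S v → ∃ f ∈ F i, ∀ u ∈ f, c u = i then 1 else 0 := by
      intro i
      by_cases hi : i ∈ S v <;> simp [hg, hi]
    rw [prod_congr rfl fun i _ => h1 i, Fintype.prod_ite_zero]
    simp only [blockedAt, mem_filter, mem_univ, true_and, prod_const_one]
    refine if_congr (forall₂_congr fun i _ => ?_) rfl rfl
    simp only [hF, mem_image, mem_filter]
    constructor
    · rintro ⟨e, he, hv, h⟩
      exact ⟨_, ⟨e, ⟨he, hv⟩, rfl⟩, h⟩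
    · rintro ⟨_, ⟨e, ⟨he, hv⟩, rfl⟩, h⟩
      exact ⟨e, he, hv, h⟩
  have hstep1 : ∑ c ∈ blockedAt E (S v) v, ∏ u, w u (c u) =
      ∑ c : V → ι, (∏ u, w u (c u)) * ∏ i, g i (fun u => decide (c u = i)) := by
    simp [← hblocked]
  have hstep2 : ∀ i, ∑ x, bernoulliWeight (fun u => w u i) x * g i x ≤
      if i ∈ S v then 1 - (1 - ((s : ℝ)⁻¹) ^ n) ^ d else 1 := by
    intro i
    by_cases hi : i ∈ S v
    · simp only [hg, hi, if_true]
      exact sum_bernoulliWeight_exists_le (fun u => hw0 u i) (fun u => hws u i)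
        (by positivity) hs1 (hFn i) (hFcard i)
    · simp [hg, hi, sum_bernoulliWeight]
  have hstep3 := prod_le_prod (s := univ) (fun i _ => sum_nonneg fun x _ => mul_nonneg
    (bernoulliWeight_nonneg (fun u => hw0 u i) (fun u => hwle u i) x) (hg0 i x))
    fun i _ => hstep2 i
  rw [prod_ite_mem, univ_inter, prod_const, hS v] at hstep3
  rw [hstep1]
  exact (sum_prod_weight_mul_prod_le hw0 hw1 hg0 hgm).trans hstep3

/-- If colors are chosen from lists of size `s` with suitable parameters, then every vertex can have
a color in its list that is not blocked. -/
lemma exists_forall_notMem_blockedAt {E : ι → Finset (Finset V)} {n d s : ℕ}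
    (hE : ∀ i, ∀ e ∈ E i, #e = n + 1) (hd : ∀ i v, #((E i).filter (v ∈ ·)) ≤ d)
    {S : V → Finset ι} (hs : 0 < s) (hS : ∀ u, #(S u) = s)
    (h2 : 2 * (1 - (1 - ((s : ℝ)⁻¹) ^ n) ^ d) ^ s < 1)
    (h4 : 4 * (1 - (1 - ((s : ℝ)⁻¹) ^ n) ^ d) ^ s * (Fintype.card ι * (d * n)) ^ 2 ≤ 1) :
    ∃ c : V → ι, (∀ u, c u ∈ S u) ∧ ∀ v, c ∉ blockedAt E (S v) v := by
  have hw0 := uniformWeight_nonneg S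
  have hw1 : ∀ u, ∑ i, uniformWeight S u i = 1 := fun u =>
    sum_uniformWeight (card_pos.1 (by rw [hS u]; exact hs))
  have hp : (0 : ℝ) ≤ (1 - (1 - ((s : ℝ)⁻¹) ^ n) ^ d) ^ s := by
    have hs1 : (s : ℝ)⁻¹ ≤ 1 := inv_le_one_of_one_le₀ (by exact_mod_cast hs)
    have hsn : ((s : ℝ)⁻¹) ^ n ≤ 1 := pow_le_one₀ (by positivity) hs1
    have h0 : 0 ≤ ((s : ℝ)⁻¹) ^ n := by positivity
    refine pow_nonneg (sub_nonneg.2 (pow_le_one₀ ?_ ?_)) _ <;> linarith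
  -- Blocking at `v` depends only on the colors of its neighbors, so only vertices sharing a
  -- neighbor with `v` matter.
  have hind : ∀ v T, Disjoint T (univ.filter fun w => ¬ Disjoint (neighbors E v) (neighbors E w)) →
      ∑ c ∈ blockedAt E (S v) v ∩ avoiding (fun v => blockedAt E (S v) v) T,
          ∏ u, uniformWeight S u (c u) ≤
        (1 - (1 - ((s : ℝ)⁻¹) ^ n) ^ d) ^ s *
          ∑ c ∈ avoiding (fun v => blockedAt E (S v) v) T, ∏ u, uniformWeight S u (c u) := by
    intro v T hT
    rw [sum_inter_eq_mul_of_dependsOn _ hw1 (neighbors E v)]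
    · exact mul_le_mul_of_nonneg_right (sum_blockedAt_le hE hd hs hS v)
        (sum_nonneg fun c _ => prod_nonneg fun u _ => hw0 u _)
    · intro c c' hcc' hc
      simp only [blockedAt, mem_filter, mem_univ, true_and] at hc ⊢
      intro i hi
      obtain ⟨e, he, hv, h⟩ := hc i hi
      exact ⟨e, he, hv, fun u hu => by
        rw [← hcc' u (mem_neighbors.2 ⟨i, e, he, hv, hu⟩), h u hu]⟩
    · intro c c' hcc' hc
      simp only [avoiding, mem_filter, mem_univ, true_and] at hc ⊢
      intro w hw hc'
      refine hc w hw ?_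
      have hdis : Disjoint (neighbors E v) (neighbors E w) := by
        by_contra hdis
        exact disjoint_left.1 hT hw (by simpa using hdis)
      simp only [blockedAt, mem_filter, mem_univ, true_and] at hc' ⊢
      intro i hi
      obtain ⟨e, he, hv, h⟩ := hc' i hi
      exact ⟨e, he, hv, fun u hu => by
        rw [hcc' u (disjoint_right.1 hdis (mem_neighbors.2 ⟨i, e, he, hv, hu⟩)), h u hu]⟩
  have hΓ : ∀ v, #(univ.filter fun w => ¬ Disjoint (neighbors E v) (neighbors E w)) ≤
      (Fintype.card ι * (d * n)) ^ 2 := by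
    intro v
    have hsub : (univ.filter fun w => ¬ Disjoint (neighbors E v) (neighbors E w)) ⊆
        (neighbors E v).biUnion fun u => neighbors E u := by
      intro w hw
      rw [mem_filter, not_disjoint_iff] at hw
      obtain ⟨-, u, hu, hu'⟩ := hw
      exact mem_biUnion.2 ⟨u, hu, neighbors_symm hu'⟩
    refine (card_le_card hsub).trans ?_
    rw [sq]
    exact (card_biUnion_le_card_mul _ _ _ fun u _ => card_neighbors_le hE hd u).trans
      (Nat.mul_le_mul_right _ (card_neighbors_le hE hd v))
  obtain ⟨c, hc, h⟩ := exists_pos_forall_notMem_of_local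
    (W := fun c : V → ι => ∏ u, uniformWeight S u (c u))
    (A := fun v => blockedAt E (S v) v)
    (Γ := fun v => univ.filter fun w => ¬ Disjoint (neighbors E v) (neighbors E w))
    (D := (Fintype.card ι * (d * n)) ^ 2)
    (fun c => prod_nonneg fun u _ => hw0 u _) (by simp [sum_prod_weight _ hw1]) hp h2 hind hΓ
    (by exact_mod_cast h4)
  refine ⟨c, fun u => ?_, h⟩
  -- A color off the list would make the weight of `c` vanish.
  by_contra hu
  refine hc.ne' (prod_eq_zero (mem_univ u) ?_)
  simp [uniformWeight, hu]

/-- A coloring without monochromatic edges of `E i` in color `i`, where `E i` consists of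
transversals of the classes of `t i`. -/
theorem exists_coloring_of_transversal {E : ι → Finset (Finset V)} {n d s : ℕ}
    {t : ι → V → Fin (n + 1)} (hE : ∀ i, ∀ e ∈ E i, #e = n + 1)
    (ht : ∀ i, ∀ e ∈ E i, ∀ j, ∃! v, v ∈ e ∧ t i v = j)
    (hd : ∀ i v, #((E i).filter (v ∈ ·)) ≤ d) (hs : 0 < s)
    (hcard : (n + 1) * s ≤ Fintype.card ι)
    (h2 : 2 * (1 - (1 - ((s : ℝ)⁻¹) ^ n) ^ d) ^ s < 1)
    (h4 : 4 * (1 - (1 - ((s : ℝ)⁻¹) ^ n) ^ d) ^ s * (Fintype.card ι * (d * n)) ^ 2 ≤ 1) :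
    ∃ c : V → ι, ∀ i, ∀ e ∈ E i, ∃ v ∈ e, c v ≠ i := by
  have hpop : ∀ v, ∃ j, ∃ S : Finset ι, #S = s ∧ ∀ i ∈ S, t i v = j := by
    intro v
    obtain ⟨j, -, hj⟩ := exists_le_card_fiber_of_mul_le_card_of_maps_to
      (s := (univ : Finset ι)) (t := (univ : Finset (Fin (n + 1)))) (f := fun i => t i v) (n := s)
      (fun _ _ => mem_univ _) univ_nonempty (by simpa using hcard)
    obtain ⟨S, hS, hSs⟩ := exists_subset_card_eq hj
    exact ⟨j, S, hSs, fun i hi => (mem_filter.1 (hS hi)).2⟩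
  choose τ S hS hτ using hpop
  obtain ⟨c, hcS, hc⟩ := exists_forall_notMem_blockedAt hE hd hs hS h2 h4
  have hfree : ∀ v, ∃ i ∈ S v, ∀ e ∈ E i, v ∈ e → ∃ u ∈ e.erase v, c u ≠ i := by
    intro v
    have := hc v
    simp only [blockedAt, mem_filter, mem_univ, true_and] at this
    push Not at this
    exact this
  choose b hbS hb using hfree
  -- Only vertices whose list places them in the last part are recolored. An edge of `E i` with `i`
  -- in all its lists has exactly one such vertex, so the colors that block there are final.
  refine ⟨fun v => if τ v = Fin.last n then b v else c v, fun i e he => ?_⟩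
  by_contra! hmono
  have hiS : ∀ v ∈ e, i ∈ S v := by
    intro v hv
    have := hmono v hv
    split_ifs at this
    · exact this ▸ hbS v
    · exact this ▸ hcS v
  obtain ⟨v, ⟨hve, hv⟩, huniq⟩ := ht i e he (Fin.last n)
  have hτv : τ v = Fin.last n := (hτ v i (hiS v hve)).symm.trans hv
  have hbv : b v = i := by simpa [hτv] using hmono v hve
  obtain ⟨u, hu, hcu⟩ := hb v e (by rwa [hbv]) hve
  rw [mem_erase] at hu
  have hτu : τ u ≠ Fin.last n := fun h =>
    hu.1 (huniq u ⟨hu.2, (hτ u i (hiS u hu.2)).trans h⟩)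
  have := hmono u hu.2
  rw [if_neg hτu] at this
  exact hcu (this.trans hbv.symm)

end Coloring

/-! ### Passage to infinite vertex sets -/

namespace Hypergraph

/-- Cooperative colorings of possibly infinite multipartite hypergraphs from the finite case. -/
theorem alwaysCooperative_multipartiteClass {n d s m : ℕ} (hs : 0 < s)
    (hm : (n + 1) * s ≤ m)
    (h2 : 2 * (1 - (1 - ((s : ℝ)⁻¹) ^ n) ^ d) ^ s < 1)
    (h4 : 4 * (1 - (1 - ((s : ℝ)⁻¹) ^ n) ^ d) ^ s * (m * (d * n)) ^ 2 ≤ 1) :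
    AlwaysCooperative.{u} (multipartiteClass.{u} (n + 1) d) m := by
  classical
  intro α V H hH hV
  have hunif : ∀ i, (H i).IsUniform (n + 1) := fun i => (hH i).1
  have hdeg : ∀ i, (H i).MaxDegreeLE d := fun i => (hH i).2.2
  choose P hPdisj hPunion hPe using fun i => (hH i).2.1
  have htex : ∀ i v, ∃ j, v ∈ V → v ∈ P i j := by
    intro i v
    by_cases hv : v ∈ V
    · rw [← hV i, ← hPunion i] at hv
      obtain ⟨j, hj⟩ := Set.mem_iUnion.1 hv
      exact ⟨j, fun _ => hj⟩
    · exact ⟨0, fun h => absurd h hv⟩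
  choose t ht using htex
  have htrans : ∀ i, ∀ e ∈ (H i).edgeSet, ∀ j, ∃! v, v ∈ e ∧ t i v = j := by
    intro i e he j
    have heV : ∀ v ∈ e, v ∈ V := fun v hv => hV i ▸ (H i).subset_vertexSet_of_mem_edgeSet' he hv
    obtain ⟨v, hv⟩ := Set.encard_eq_one.1 (hPe i e he j)
    have hv' : v ∈ e ∩ P i j := hv ▸ Set.mem_singleton v
    refine ⟨v, ⟨hv'.1, ?_⟩, ?_⟩
    · by_contra hne
      exact Set.disjoint_left.1 (hPdisj i hne) (ht i v (heV v hv'.1)) hv'.2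
    · rintro u ⟨hu, rfl⟩
      have : u ∈ e ∩ P i (t i u) := ⟨hu, ht i u (heV u hu)⟩
      rw [hv] at this
      exact this
  -- Only edges contained in `T` are kept, so uniformity and the transversal property survive.
  let E (T : Finset α) (i : Fin m) : Finset (Finset T) :=
    univ.filter fun e => ((e.map (Function.Embedding.subtype _) : Finset α) : Set α) ∈ (H i).edgeSet
  have hfin : ∀ T : Finset α, ∃ c : T → Fin m, ∀ i, ∀ e ∈ E T i, ∃ v ∈ e, c v ≠ i := by
    intro T
    refine exists_coloring_of_transversal (n := n) (d := d) (s := s) (t := fun i v => t i v)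
      ?_ ?_ ?_ hs (by simpa using hm) h2 (by simpa using h4)
    · intro i e he
      have := hunif i _ (mem_filter.1 he).2
      rw [Set.encard_coe_eq_coe_finsetCard, card_map] at this
      exact_mod_cast this
    · intro i e he j
      obtain ⟨v, ⟨hv, hvj⟩, huniq⟩ := htrans i _ (mem_filter.1 he).2 j
      obtain ⟨v', hv', rfl⟩ := mem_map.1 (mem_coe.1 hv)
      refine ⟨v', ⟨hv', hvj⟩, fun u hu => Subtype.ext (huniq u ⟨?_, hu.2⟩)⟩
      exact mem_coe.2 (mem_map_of_mem _ hu.1)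
    · intro i v
      by_cases hvV : (v : α) ∈ V
      · have h := hdeg i v (by rw [hV i]; exact hvV)
        have hle : ((((E T i).filter (v ∈ ·) : Finset (Finset T)) : Set (Finset T))).encard ≤
            (H i).edgeDegree v := by
          refine Set.encard_le_encard_of_injOn (f := fun e : Finset T =>
            ((e.map (Function.Embedding.subtype _) : Finset α) : Set α)) ?_ ?_
          · intro e he
            obtain ⟨he, hv⟩ := mem_filter.1 (mem_coe.1 he)
            exact ⟨(mem_filter.1 he).2, mem_coe.2 (mem_map_of_mem _ hv)⟩
          · intro e _ e' _ h
            exact map_injective _ (coe_injective h)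
        rw [Set.encard_coe_eq_coe_finsetCard] at hle
        exact_mod_cast hle.trans h
      · rw [filter_eq_empty_iff.2]
        · simp
        · intro e he hv
          refine hvV (hV i ▸ (H i).subset_vertexSet_of_mem_edgeSet' (mem_filter.1 he).2 ?_)
          exact mem_coe.2 (mem_map_of_mem (Function.Embedding.subtype _) hv)
  choose g hg using hfin
  -- Rado selection: on each finite set, hence on each edge, `χ` agrees with the coloring of some
  -- larger finite `T`.
  obtain ⟨χ, hχ⟩ := Finset.rado_selection_subtype (β := fun _ : α => Fin m) g
  refine ⟨fun i => {v | v ∈ V ∧ χ v = i}, ?_, ?_, fun i => ⟨?_, ?_⟩⟩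
  · intro i j hij
    exact Set.disjoint_left.2 fun v hv hv' => hij (hv.2.symm.trans hv'.2)
  · ext v
    simp
  · rw [hV i]
    exact fun v hv => hv.1
  · intro e he hsub
    have hef : e.Finite := Set.finite_of_encard_eq_coe (hunif i e he)
    obtain ⟨T, hT, hχT⟩ := hχ hef.toFinset
    have hmem : hef.toFinset.subtype (· ∈ T) ∈ E T i := by
      refine mem_filter.2 ⟨mem_univ _, ?_⟩
      have : (hef.toFinset.subtype (· ∈ T)).map (Function.Embedding.subtype _) = hef.toFinset :=
        subtype_map_of_mem fun x hx => hT hx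
      rw [this]
      simpa using he
    obtain ⟨v, hv, hne⟩ := hg T i _ hmem
    rw [mem_subtype] at hv
    have h1 := hχT ⟨v, hv⟩
    have h3 : χ v = i := (hsub (hef.mem_toFinset.1 hv)).2
    exact hne (h1.symm.trans h3)

lemma AlwaysCooperative.mono {𝓗 𝓗' : ∀ α : Type u, Set (Hypergraph α)} {m : ℕ}
    (h : AlwaysCooperative 𝓗' m) (hsub : ∀ α, 𝓗 α ⊆ 𝓗' α) : AlwaysCooperative 𝓗 m :=
  fun α V H hH hV => h α V H (fun i => hsub α (hH i)) hV

lemma multipartiteClass_mono (k : ℕ) {d d' : ℕ} (h : d ≤ d') (α : Type u) :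
    multipartiteClass k d α ⊆ multipartiteClass k d' α :=
  fun _ hH => ⟨hH.1, hH.2.1, fun v hv => (hH.2.2 v hv).trans (by exact_mod_cast h)⟩

/-! ### Lower bound construction -/

/-- On `Fin k`-valued words of length `m`, the complete `k`-partite hypergraph whose parts are
given by the `i`-th letter. -/
def letterHypergraph (k m : ℕ) (i : Fin m) : Hypergraph (ULift.{u} (Fin m → Fin k)) where
  vertexSet := Set.univ
  edgeSet := {e | ∃ f : Fin k → ULift.{u} (Fin m → Fin k),
    (∀ j, (f j).down i = j) ∧ Set.range f = e}
  subset_vertexSet_of_mem_edgeSet' _ _ := Set.subset_univ _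

/-- An edge at `v` is determined by its vertices in the other `k - 1` parts. Counting all `k ^ m`
words for each of them, without fixing the `i`-th letter, is crude but gives the stated bound. -/
lemma letterHypergraph_mem_multipartiteClass {k m d : ℕ} (hd : k ^ (m * (k - 1)) ≤ d)
    (i : Fin m) : letterHypergraph.{u} k m i ∈ multipartiteClass.{u} k d _ := by
  refine ⟨?_, ⟨fun j => {v | v.down i = j}, ?_, ?_, ?_⟩, ?_⟩
  · rintro _ ⟨f, hf, rfl⟩
    have hinj : Function.Injective f := fun a b hab => by rw [← hf a, ← hf b, hab]
    rw [← Set.image_univ, hinj.encard_image]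
    simp
  · intro a b hab
    exact Set.disjoint_left.2 fun v hv hv' => hab (hv.symm.trans hv')
  · ext v
    simp [letterHypergraph]
  · rintro _ ⟨f, hf, rfl⟩ j
    rw [Set.encard_eq_one]
    refine ⟨f j, ?_⟩
    ext v
    constructor
    · rintro ⟨⟨a, rfl⟩, ha⟩
      have : a = j := (hf a).symm.trans ha
      rw [this]
      rfl
    · rintro rfl
      exact ⟨⟨j, rfl⟩, hf j⟩
  · intro v _
    let Φ (g : {j // j ≠ v.down i} → ULift.{u} (Fin m → Fin k)) :
        Set (ULift.{u} (Fin m → Fin k)) :=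
      Set.range fun j => if h : j = v.down i then v else g ⟨j, h⟩
    have hsub : {e ∈ (letterHypergraph.{u} k m i).edgeSet | v ∈ e} ⊆ Φ '' Set.univ := by
      rintro _ ⟨⟨f, hf, rfl⟩, ⟨j, hj⟩⟩
      refine ⟨fun j => f j, Set.mem_univ _, ?_⟩
      have hji : v.down i = j := by rw [← hj, hf]
      refine congrArg Set.range (funext fun a => ?_)
      by_cases h : a = v.down i
      · rw [dif_pos h, h, hji, hj]
      · rw [dif_neg h]
    refine (Set.encard_le_encard hsub).trans ((Set.encard_image_le _ _).trans ?_)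
    rw [Set.encard_univ, ENat.card_eq_coe_fintype_card]
    have hcard : Fintype.card ({j // j ≠ v.down i} → ULift.{u} (Fin m → Fin k)) =
        k ^ (m * (k - 1)) := by
      simp [pow_mul]
    rw [hcard]
    exact_mod_cast hd

/-- A diagonal argument: a class meeting all `k` parts would contain an edge, so the `i`-th class
misses some letter `a i` in position `i`, and the word `a` is in no class. -/
theorem AlwaysCooperative.lt_pow {k m d : ℕ}
    (h : AlwaysCooperative.{u} (multipartiteClass.{u} k d) m) : d < k ^ (m * (k - 1)) := by
  by_contra! hd
  obtain ⟨I, -, hunion, hind⟩ := h _ Set.univ (letterHypergraph.{u} k m)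
    (letterHypergraph_mem_multipartiteClass hd) fun _ => rfl
  have hmiss : ∀ i, ∃ a : Fin k, ∀ v ∈ I i, v.down i ≠ a := by
    intro i
    by_contra! hall
    choose f hfI hf using hall
    exact (hind i).2 _ ⟨f, hf, rfl⟩ (Set.range_subset_iff.2 hfI)
  choose a ha using hmiss
  have hmem : (ULift.up a : ULift.{u} (Fin m → Fin k)) ∈ ⋃ i, I i := hunion ▸ Set.mem_univ _
  obtain ⟨i, hi⟩ := Set.mem_iUnion.1 hmem
  exact ha i _ hi rfl

end Hypergraph

/-! ### Choice of parameters and asymptotics -/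

lemma exp_neg_div_one_sub_le {y : ℝ} (hy : y < 1) : Real.exp (-(y / (1 - y))) ≤ 1 - y := by
  have h1 : 0 < 1 - y := by linarith
  have h2 := Real.add_one_le_exp (y / (1 - y))
  have h3 : y / (1 - y) + 1 = (1 - y)⁻¹ := by
    field_simp
    ring
  rw [Real.exp_neg]
  rw [h3] at h2
  exact inv_le_of_inv_le₀ h1 h2

/-- The probability that all `s` colors of a list are blocked is small when `s` is slightly larger
than `(n d / log d) ^ (1 / n)`. -/
lemma blocked_probability_le {n d s : ℕ} {δ x : ℝ} (hn : 1 ≤ n) (hδ : 0 < δ) (hx0 : 0 < x)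
    (hL : 1 ≤ Real.log d) (hx : x ^ n = n * d / Real.log d)
    (hs : (1 + δ) * x ≤ s) (hpow : 5 ^ n * Real.log d ^ (n + 1) ≤ (d : ℝ) ^ (1 - 1 / (1 + δ / 2)))
    (hlog : Real.log d ≤ δ / 2 * d) (hd : (1 : ℝ) ≤ d) :
    (1 - (1 - ((s : ℝ)⁻¹) ^ n) ^ d) ^ s ≤ ((d : ℝ) ^ 5)⁻¹ := by
  set L := Real.log d with hLdef
  set θ := 1 / (1 + δ / 2) with hθ
  have hn' : (1 : ℝ) ≤ n := by exact_mod_cast hn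
  have hexp : Real.exp L = d := Real.exp_log (by linarith)
  have hspos : (0 : ℝ) < s := by nlinarith
  have hsn : (1 + δ) * (n * d / L) ≤ (s : ℝ) ^ n := by
    rw [← hx]
    calc (1 + δ) * x ^ n ≤ (1 + δ) ^ n * x ^ n := by
          gcongr
          exact le_self_pow₀ (by linarith) (by omega)
      _ = ((1 + δ) * x) ^ n := by rw [mul_pow]
      _ ≤ _ := by gcongr
  set Y := ((s : ℝ)⁻¹) ^ n with hY
  have hY0 : 0 ≤ Y := by positivity
  have hYle : Y ≤ L / ((1 + δ) * (n * d)) := by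
    rw [hY, inv_pow]
    refine inv_le_of_inv_le₀ (by positivity) ?_
    rw [inv_div, mul_div_assoc]
    exact hsn
  have hYd : Y * ((1 + δ) * (n * d)) ≤ L := by
    rwa [le_div_iff₀ (by positivity)] at hYle
  have hYsmall : Y * (1 + δ) ≤ δ / 2 := by
    have h1 : Y * (1 + δ) * d ≤ Y * ((1 + δ) * (n * d)) := by
      have : 0 ≤ Y * (1 + δ) * d := by positivity
      nlinarith
    have h2 : Y * (1 + δ) * d ≤ δ / 2 * d := by linarith
    exact le_of_mul_le_mul_right h2 (by linarith)
  have hY1 : Y < 1 := by nlinarith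
  -- Half of the slack `δ` in `s` absorbs the factor `1 / (1 - Y)`; the other half leaves `θ < 1`.
  have hdY : d * (Y / (1 - Y)) * n ≤ θ * L := by
    have h1 : 0 < 1 - Y := by linarith
    have h2 : 1 + δ / 2 ≤ (1 + δ) * (1 - Y) := by nlinarith
    rw [hθ, one_div_mul_eq_div, le_div_iff₀ (by positivity)]
    calc d * (Y / (1 - Y)) * n * (1 + δ / 2) ≤ d * (Y / (1 - Y)) * n * ((1 + δ) * (1 - Y)) := by
          gcongr
      _ = Y * ((1 + δ) * (n * d)) := by
          field_simp
      _ ≤ L := hYd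
  set a := (1 - Y) ^ d with ha
  have ha0 : 0 ≤ a := pow_nonneg (by linarith) d
  have ha1 : a ≤ 1 := pow_le_one₀ (by linarith) (by linarith)
  have han : Real.exp (-(θ * L)) ≤ a ^ n := by
    calc Real.exp (-(θ * L)) ≤ Real.exp (-(d * (Y / (1 - Y)) * n)) :=
          Real.exp_le_exp.2 (by linarith)
      _ = (Real.exp (-(Y / (1 - Y))) ^ d) ^ n := by
          rw [← Real.exp_nat_mul, ← Real.exp_nat_mul]
          congr 1
          ring
      _ ≤ a ^ n := by
          rw [ha]
          gcongr
          exact exp_neg_div_one_sub_le hY1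
  -- Compare `n`-th powers: `s ^ n * a ^ n` is at least `d ^ (1 - θ) / L`, which beats any power of
  -- `L`. The 5 yields `d⁻⁵`, one power more than the `d ^ 4` of the dependency bound.
  have hsa : 5 * L ≤ s * a := by
    refine (pow_le_pow_iff_left₀ (by linarith) (by positivity) (by omega : n ≠ 0)).1 ?_
    have hsn' : d / L ≤ (s : ℝ) ^ n := by
      refine le_trans ?_ hsn
      rw [mul_div_assoc]
      have : 0 ≤ d / L := by positivity
      nlinarith [mul_nonneg hδ.le this, mul_nonneg (mul_nonneg hδ.le this) (sub_nonneg.2 hn')]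
    calc (5 * L) ^ n = 5 ^ n * L ^ (n + 1) / L := by
          rw [pow_succ, mul_pow]
          field_simp
      _ ≤ (d : ℝ) ^ (1 - θ) / L := by gcongr
      _ = d / L * Real.exp (-(θ * L)) := by
          rw [Real.rpow_def_of_pos (by linarith), ← hLdef, mul_sub, mul_one, sub_eq_add_neg,
            Real.exp_add, hexp, mul_comm L θ]
          ring
      _ ≤ (s : ℝ) ^ n * a ^ n := by gcongr
      _ = (s * a) ^ n := by rw [mul_pow]
  calc (1 - a) ^ s ≤ Real.exp (-a) ^ s := by
        gcongr
        linarith [Real.add_one_le_exp (-a)]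
    _ = Real.exp (-(s * a)) := by
        rw [← Real.exp_nat_mul]
        congr 1
        ring
    _ ≤ Real.exp (-(5 * L)) := Real.exp_le_exp.2 (by linarith)
    _ = ((d : ℝ) ^ 5)⁻¹ := by
        rw [Real.exp_neg, ← hexp, ← Real.exp_nat_mul]
        norm_num

/-- The conditions of the local lemma hold for lists of size `s` slightly larger than
`(n d / log d) ^ (1 / n)`. -/
lemma local_lemma_parameters {n d s : ℕ} {δ x : ℝ} (hn : 1 ≤ n) (hδ : 0 < δ) (hδ1 : δ ≤ 1)
    (hL : 1 ≤ Real.log d) (hx1 : 1 ≤ x) (hx : x ^ n = n * d / Real.log d)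
    (hs : (1 + δ) * x ≤ s) (hs' : s ≤ (1 + δ) * x + 1)
    (hpow : 5 ^ n * Real.log d ^ (n + 1) ≤ (d : ℝ) ^ (1 - 1 / (1 + δ / 2)))
    (hlog : Real.log d ≤ δ / 2 * d) (hC : 36 * ((n : ℝ) + 1) ^ 2 * n ^ 4 ≤ d) :
    2 * (1 - (1 - ((s : ℝ)⁻¹) ^ n) ^ d) ^ s < 1 ∧
      4 * (1 - (1 - ((s : ℝ)⁻¹) ^ n) ^ d) ^ s * (((n + 1) * s : ℕ) * (d * n)) ^ 2 ≤ 1 := by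
  have hn' : (1 : ℝ) ≤ n := by exact_mod_cast hn
  have hd : (1 : ℝ) ≤ d := by nlinarith [pow_pos (show (0 : ℝ) < n by linarith) 4]
  have hq := blocked_probability_le hn hδ (by linarith) hL hx hs hpow hlog hd
  set q := (1 - (1 - ((s : ℝ)⁻¹) ^ n) ^ d) ^ s
  have hd5 : (d : ℝ) ≤ d ^ 5 := le_self_pow₀ hd (by norm_num)
  have hd36 : (36 : ℝ) ≤ d := by
    have h1 : (1 : ℝ) ≤ ((n : ℝ) + 1) ^ 2 := one_le_pow₀ (by linarith)
    have h2 : (1 : ℝ) ≤ (n : ℝ) ^ 4 := one_le_pow₀ hn'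
    nlinarith
  have hs3 : (s : ℝ) ≤ 3 * (n * d) := by
    have h1 : x ≤ n * d := by
      calc x ≤ x ^ n := le_self_pow₀ hx1 (by omega)
        _ = n * d / Real.log d := hx
        _ ≤ n * d := div_le_self (by positivity) hL
    nlinarith
  constructor
  · have h1 : ((d : ℝ) ^ 5)⁻¹ ≤ 36⁻¹ := by
      gcongr
      linarith
    linarith
  · have h1 : 4 * ((((n + 1) * s : ℕ) : ℝ) * (d * n)) ^ 2 ≤ d ^ 5 := by
      push_cast
      calc 4 * (((n : ℝ) + 1) * s * (d * n)) ^ 2 ≤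
            4 * (((n : ℝ) + 1) * (3 * (n * d)) * (d * n)) ^ 2 := by gcongr
        _ = 36 * ((n : ℝ) + 1) ^ 2 * n ^ 4 * d ^ 4 := by ring
        _ ≤ d * d ^ 4 := by gcongr
        _ = d ^ 5 := by ring
    have h0 : (0 : ℝ) < (d : ℝ) ^ 5 := by positivity
    calc 4 * q * ((((n + 1) * s : ℕ) : ℝ) * (d * n)) ^ 2
        = q * (4 * ((((n + 1) * s : ℕ) : ℝ) * (d * n)) ^ 2) := by ring
      _ ≤ ((d : ℝ) ^ 5)⁻¹ * d ^ 5 := mul_le_mul hq h1 (by positivity) (by positivity)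
      _ = 1 := inv_mul_cancel₀ h0.ne'

/-- The size `k X` with `X ^ (k - 1) = (k - 1) d / log d` is an asymptotic upper bound. -/
lemma eventually_exists_alwaysCooperative {n : ℕ} (hn : 1 ≤ n) {δ : ℝ} (hδ : 0 < δ)
    (hδ1 : δ ≤ 1) :
    ∀ᶠ d : ℕ in atTop, ∃ m : ℕ,
      Hypergraph.AlwaysCooperative.{u} (Hypergraph.multipartiteClass.{u} (n + 1) d) m ∧
      (m : ℝ) ≤ (n + 1) * ((1 + 2 * δ) * ((n : ℝ) * d / Real.log d) ^ (1 / (n : ℝ))) := by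
  have hn' : (1 : ℝ) ≤ n := by exact_mod_cast hn
  have hθ : 0 < 1 - 1 / (1 + δ / 2) := by
    rw [sub_pos, div_lt_one (by linarith)]
    linarith
  have hcast := tendsto_natCast_atTop_atTop (R := ℝ)
  have e1 : ∀ᶠ d : ℕ in atTop, 1 ≤ Real.log d :=
    (Real.tendsto_log_atTop.comp hcast).eventually_ge_atTop 1
  have e2 : ∀ᶠ d : ℕ in atTop,
      5 ^ n * Real.log d ^ (n + 1) ≤ (d : ℝ) ^ (1 - 1 / (1 + δ / 2)) := by
    have h := (isLittleO_log_rpow_rpow_atTop ((n + 1 : ℕ) : ℝ) hθ).def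
      (show (0 : ℝ) < (5 ^ n)⁻¹ by positivity)
    filter_upwards [hcast.eventually h, e1] with d hd h1
    rw [Real.rpow_natCast, Real.norm_of_nonneg (by positivity),
      Real.norm_of_nonneg (by positivity), inv_mul_eq_div, le_div_iff₀ (by positivity)] at hd
    linarith
  have elog : ∀ c : ℝ, 0 < c → ∀ᶠ d : ℕ in atTop, Real.log d ≤ c * d := by
    intro c hc
    filter_upwards [hcast.eventually (Real.isLittleO_log_id_atTop.def hc), e1] with d hd h1
    rwa [Real.norm_of_nonneg (by linarith), id, Real.norm_of_nonneg (by positivity)] at hd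
  filter_upwards [e1, e2, elog (δ / 2) (by linarith), elog (δ ^ n) (by positivity),
    hcast.eventually_ge_atTop (36 * ((n : ℝ) + 1) ^ 2 * n ^ 4)] with d hL hpow hlog hlog' hC
  set x := ((n : ℝ) * d / Real.log d) ^ (1 / (n : ℝ)) with hx
  have hx0 : 0 ≤ x := by positivity
  have hxn : x ^ n = n * d / Real.log d := by
    rw [hx, one_div, Real.rpow_inv_natCast_pow (by positivity) (by omega)]
  -- Rounding `(1 + δ) x` up to an integer thus costs at most another `δ x`.
  have hxδ : 1 ≤ δ * x := by
    refine (pow_le_pow_iff_left₀ zero_le_one (by positivity) (by omega : n ≠ 0)).1 ?_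
    rw [one_pow, mul_pow, hxn, ← mul_div_assoc, le_div_iff₀ (by linarith)]
    have : 0 ≤ δ ^ n * d := by positivity
    nlinarith
  have hx1 : 1 ≤ x := by nlinarith
  have hs0 : 0 ≤ (1 + δ) * x := by positivity
  have hs := Nat.le_ceil ((1 + δ) * x)
  have hs' := (Nat.ceil_lt_add_one hs0).le
  obtain ⟨h2, h4⟩ := local_lemma_parameters hn hδ hδ1 hL hx1 hxn hs hs' hpow hlog hC
  refine ⟨_, Hypergraph.alwaysCooperative_multipartiteClass (Nat.ceil_pos.2 (by nlinarith)) le_rfl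
    h2 h4,
    ?_⟩
  push_cast
  gcongr
  linarith

theorem mainTheorem3 (k : ℕ) (hk : 2 ≤ k) :
    ∃ M : ℕ → ℕ,
      (∀ d : ℕ, 2 ≤ d →
        Hypergraph.IsCooperativeChromaticNumber.{u} (Hypergraph.multipartiteClass.{u} k d) (M d)) ∧
      (∀ d : ℕ, 2 ≤ d → Real.logb (k : ℝ) (d : ℝ) / ((k : ℝ) - 1) ≤ (M d : ℝ)) ∧
      ∃ ε : ℕ → ℝ, Tendsto ε atTop (𝓝 0) ∧
        ∀ d : ℕ, 2 ≤ d →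
          (M d : ℝ) ≤ (k : ℝ) * (1 + ε d) *
            (((k : ℝ) - 1) * (d : ℝ) / Real.log (d : ℝ)) ^ (1 / ((k : ℝ) - 1)) := by
  obtain ⟨n, rfl⟩ : ∃ n, k = n + 1 := ⟨k - 1, by omega⟩
  have hn : 1 ≤ n := by omega
  have hn' : (1 : ℝ) ≤ n := by exact_mod_cast hn
  have hkn : ((n + 1 : ℕ) : ℝ) - 1 = n := by push_cast; ring
  rw [hkn]
  set S : ℕ → Set ℕ := fun d =>
    {m | Hypergraph.AlwaysCooperative.{u} (Hypergraph.multipartiteClass.{u} (n + 1) d) m} with hS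
  -- The estimate holds only for large degrees; small `d` are covered because the class grows with
  -- `d`.
  have hne : ∀ d, (S d).Nonempty := by
    intro d
    obtain ⟨d', hdd', m, hm, -⟩ := ((eventually_ge_atTop d).and
      (eventually_exists_alwaysCooperative.{u} hn one_pos le_rfl)).exists
    exact ⟨m, hm.mono (Hypergraph.multipartiteClass_mono (n + 1) hdd')⟩
  have hM : ∀ d, IsLeast (S d) (sInf (S d)) := fun d =>
    ⟨Nat.sInf_mem (hne d), fun m hm => Nat.sInf_le hm⟩
  have hX : ∀ d : ℕ, 2 ≤ d → 0 < ((n : ℝ) * d / Real.log d) ^ (1 / (n : ℝ)) := by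
    intro d hd
    have hd' : (2 : ℝ) ≤ d := by exact_mod_cast hd
    have := Real.log_pos (show (1 : ℝ) < d by linarith)
    positivity
  -- `ε` is the exact relative excess, cut off at 0 so that only upper estimates are needed for its
  -- limit.
  refine ⟨fun d => sInf (S d), fun d _ => hM d, fun d hd => ?_, fun d => max 0
    ((sInf (S d) : ℕ) / ((n + 1 : ℕ) * ((n : ℝ) * d / Real.log d) ^ (1 / (n : ℝ))) - 1), ?_, ?_⟩
  · have hlt : d < (n + 1) ^ (sInf (S d) * (n + 1 - 1)) :=
      Hypergraph.AlwaysCooperative.lt_pow (hM d).1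
    rw [Nat.add_sub_cancel] at hlt
    have hlt' : (d : ℝ) ≤ ((n + 1 : ℕ) : ℝ) ^ ((sInf (S d) * n : ℕ) : ℝ) := by
      rw [Real.rpow_natCast]
      exact_mod_cast hlt.le
    have h1 : (1 : ℝ) < ((n + 1 : ℕ) : ℝ) := by exact_mod_cast (by omega : 1 < n + 1)
    rw [div_le_iff₀ (by linarith), Real.logb_le_iff_le_rpow h1 (by positivity)]
    exact_mod_cast hlt'
  · refine tendsto_order.2 ⟨fun a ha => Eventually.of_forall fun d =>
      ha.trans_le (le_max_left _ _), fun a ha => ?_⟩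
    -- With this `δ` the excess is at most `2 δ ≤ a / 2 < a`.
    filter_upwards [eventually_exists_alwaysCooperative.{u} hn (δ := min 1 (a / 4))
      (lt_min one_pos (by linarith)) (min_le_left _ _), eventually_ge_atTop 2] with d hd h2
    obtain ⟨m, hm, hle⟩ := hd
    have hpos := hX d h2
    set X := ((n : ℝ) * d / Real.log d) ^ (1 / (n : ℝ))
    refine max_lt ha ?_
    have h3 : ((sInf (S d) : ℕ) : ℝ) ≤ m := by exact_mod_cast (hM d).2 hm
    rw [sub_lt_iff_lt_add, div_lt_iff₀ (by positivity)]
    push_cast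
    have h4 : min 1 (a / 4) ≤ a / 4 := min_le_right _ _
    have h5 : 0 < ((n : ℝ) + 1) * X := by positivity
    nlinarith
  · intro d hd
    have hpos := hX d hd
    set X := ((n : ℝ) * d / Real.log d) ^ (1 / (n : ℝ))
    have hkX : 0 < ((n + 1 : ℕ) : ℝ) * X := by positivity
    have h := le_max_right 0 ((sInf (S d) : ℕ) / (((n + 1 : ℕ) : ℝ) * X) - 1)
    rw [sub_le_iff_le_add, div_le_iff₀ hkX] at h
    linarith
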